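/- All topological spaces are Hausdorff. A Clifford semigroup is a semigroup $S$ in which every $x$ has a unique $x^{-1}$ with $xx^{-1}x=x$ and $x^{-1}xx^{-1}=x^{-1}$, and in which moreover $xx^{-1}=x^{-1}x$ for all $x\in S$; it is a topological Clifford semigroup if it carries a topology making multiplication and inversion continuous. Put $E=\{e\in S: ee=e\}$ (the maximal semilattice of $S$, with the subspace topology), $\pi:S\to E$, $\pi(x)=xx^{-1}$, and $H_e=\{x\in S: xx^{-1}=e=x^{-1}x\}$ for $e\in E$ (the maximal subgroups of $S$). For $x\in E$ let ${\uparrow}x=\{y\in E: xy=x=yx\}$, and for $x,y\in E$ write $x\ll y$ if $y$ lies in the interior of ${\uparrow}x$ in $E$. We call $S$ a topological Clifford $U$-semigroup if for every open set $U\subset E$ and every $x\in U$ there is $y\in U$ with $y\ll x$. We call $S$ ditopological if for every $x\in S$ and every neighborhood $O_x\subset S$ of $x$ there are neighborhoods $U_x\subset S$ of $x$ and $W\subset E$ of $\pi(x)$ such that every $y\in S$ with $\pi(y)\in W$ and $yw\in U_x$ for some $w\in W$ belongs to $O_x$. A topological semigroup $X$ (a semigroup with a topology making multiplication continuous) is precompact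 if there is a semigroup homomorphism from $X$ to a compact topological semigroup that is a topological embedding. **Theorem.** A topological Clifford $U$-semigroup $S$ is precompact if and only if the following three conditions hold: 1. the maximal semilattice $E$ of $S$ is precompact; 2. every maximal subgroup $H_e$, $e\in E$, of $S$ is precompact; 3. $S$ is ditopological. -/

import Mathlib

open Topology Set

namespace CliffordU

universe u

/-- An inverse semigroup: every `x` has exactly one `y` with `x y x = x` and `y x y = y`;
this unique element is recorded as `x⁻¹`. -/
class InverseSemigroup (S : Type u) extends Semigroup S, Inv S where
  mul_inv_mul : ∀ x : S, x * x⁻¹ * x = x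
  inv_mul_inv : ∀ x : S, x⁻¹ * x * x⁻¹ = x⁻¹
  eq_inv : ∀ x y : S, x * y * x = x → y * x * y = y → y = x⁻¹

/-- A Clifford semigroup: an inverse semigroup in which `x x⁻¹ = x⁻¹ x`. -/
class CliffordSemigroup (S : Type u) extends InverseSemigroup S where
  mul_inv_eq_inv_mul : ∀ x : S, x * x⁻¹ = x⁻¹ * x

/-- A semilattice, written multiplicatively: a commutative semigroup of idempotents. -/
class MulSemilattice (E : Type u) extends CommSemigroup E where
  mul_self : ∀ x : E, x * x = x

section Semilattice

variable {E : Type u} [MulSemilattice E]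

/-- The upper cone `↑x = {y | x ≤ y}` for the order `x ≤ y ↔ x y = x = y x`. -/
def upperCone (x : E) : Set E := {y | x * y = x ∧ y * x = x}

/-- The relation `x ≪ y`: the point `y` is interior to the upper cone of `x`. -/
def WayBelow [TopologicalSpace E] (x y : E) : Prop := y ∈ interior (upperCone x)

variable (E) in
/-- A `U`-semilattice: each open `U` and `x ∈ U` admit `y ∈ U` with `y ≪ x`. -/
def IsUSemilattice [TopologicalSpace E] : Prop :=
  ∀ U : Set E, IsOpen U → ∀ x ∈ U, ∃ y ∈ U, WayBelow y x

end Semilattice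

/-- A topological semigroup is precompact if it embeds (by a homomorphism that is a topological
embedding) into a compact Hausdorff topological semigroup. -/
def IsPrecompact (X : Type u) [Semigroup X] [TopologicalSpace X] : Prop :=
  ∃ (K : Type u) (_ : Semigroup K) (_ : TopologicalSpace K),
    ContinuousMul K ∧ T2Space K ∧ CompactSpace K ∧ ∃ h : X →ₙ* K, IsEmbedding h

section Inverse

variable {S : Type u} [InverseSemigroup S]

theorem eq_inv_of_idem {e : S} (he : e * e = e) : e = e⁻¹ :=
  InverseSemigroup.eq_inv e e (by rw [he, he]) (by rw [he, he])

theorem idem_mul {e f : S} (he : e * e = e) (hf : f * f = f) :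
    (e * f) * (e * f) = e * f := by
  have h1 := InverseSemigroup.mul_inv_mul (e * f)
  have h2 := InverseSemigroup.inv_mul_inv (e * f)
  have h3 := InverseSemigroup.eq_inv (e * f)⁻¹ (e * f) h2 h1
  have h4 := InverseSemigroup.eq_inv (e * f) (f * (e * f)⁻¹ * e)
  generalize (e * f)⁻¹ = x at h1 h2 h3 h4
  have h5 : f * x * e = x := by
    apply h4
    · calc e * f * (f * x * e) * (e * f) = e * (f * f) * x * (e * e) * f := by
            simp only [mul_assoc]
        _ = e * f * x * (e * f) := by rw [he, hf]; simp only [mul_assoc]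
        _ = e * f := h1
    · calc f * x * e * (e * f) * (f * x * e) = f * x * (e * e) * (f * f) * x * e := by
            simp only [mul_assoc]
        _ = f * (x * (e * f) * x) * e := by rw [he, hf]; simp only [mul_assoc]
        _ = f * x * e := by rw [h2]
  have h6 : x * x = x := by
    calc x * x = (f * x * e) * (f * x * e) := by rw [h5]
      _ = f * (x * (e * f) * x) * e := by simp only [mul_assoc]
      _ = x := by rw [h2, h5]
  rw [h3, ← eq_inv_of_idem h6, h6]

theorem idem_comm {e f : S} (he : e * e = e) (hf : f * f = f) : e * f = f * e := by
  have h1 := idem_mul he hf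
  have h2 := idem_mul hf he
  rw [InverseSemigroup.eq_inv (e * f) (f * e) _ _, ← eq_inv_of_idem h1]
  · calc e * f * (f * e) * (e * f) = e * (f * f) * (e * e) * f := by simp only [mul_assoc]
      _ = e * f := by rw [he, hf, mul_assoc (e * f), h1]
  · calc f * e * (e * f) * (f * e) = f * (e * e) * (f * f) * e := by simp only [mul_assoc]
      _ = f * e := by rw [he, hf, mul_assoc (f * e), h2]

variable (S) in
/-- The maximal semilattice `E = {e | e e = e}`. -/
def maxSemilattice : Subsemigroup S where
  carrier := {e | e * e = e}
  mul_mem' := fun he hf => idem_mul he hf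

instance : MulSemilattice (maxSemilattice S) where
  mul_comm := fun a b => Subtype.ext (idem_comm a.2 b.2)
  mul_self := fun a => Subtype.ext a.2

/-- The projection `π : S → E`, `π x = x x⁻¹`. -/
def proj (x : S) : maxSemilattice S :=
  ⟨x * x⁻¹, by
    change x * x⁻¹ * (x * x⁻¹) = x * x⁻¹
    rw [← mul_assoc, InverseSemigroup.mul_inv_mul]⟩

theorem mul_inv_rev_of_eq {x y e : S} (hx : x * x⁻¹ = e ∧ x⁻¹ * x = e)
    (hy : y * y⁻¹ = e ∧ y⁻¹ * y = e) :
    (x * y) * (y⁻¹ * x⁻¹) = e ∧ (y⁻¹ * x⁻¹) * (x * y) = e := by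
  constructor
  · calc (x * y) * (y⁻¹ * x⁻¹) = x * (y * y⁻¹) * x⁻¹ := by simp only [mul_assoc]
      _ = x * x⁻¹ * x * x⁻¹ := by rw [hy.1, ← hx.2]; simp only [mul_assoc]
      _ = e := by rw [InverseSemigroup.mul_inv_mul, hx.1]
  · calc (y⁻¹ * x⁻¹) * (x * y) = y⁻¹ * (x⁻¹ * x) * y := by simp only [mul_assoc]
      _ = y⁻¹ * y * y⁻¹ * y := by rw [hx.2, ← hy.1]; simp only [mul_assoc]
      _ = e := by rw [InverseSemigroup.inv_mul_inv, hy.2]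

/-- The maximal subgroup `H_e = {x | x x⁻¹ = e = x⁻¹ x}` of `S` containing the idempotent `e`,
regarded as a subsemigroup of `S`. -/
def maxSubgroup (e : maxSemilattice S) : Subsemigroup S where
  carrier := {x | x * x⁻¹ = e ∧ x⁻¹ * x = e}
  mul_mem' := by
    intro x y hx hy
    have h := mul_inv_rev_of_eq hx hy
    have h' : y⁻¹ * x⁻¹ = (x * y)⁻¹ := by
      apply InverseSemigroup.eq_inv
      · rw [h.1, ← hx.1, ← mul_assoc, InverseSemigroup.mul_inv_mul]
      · rw [h.2, ← hy.2, ← mul_assoc, InverseSemigroup.inv_mul_inv]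
    rw [h'] at h
    exact h

end Inverse

/-- `B ÷ A = {x | ∃ b ∈ B, ∃ a ∈ A, b = x a}`. -/
def rightDivision {S : Type u} [Semigroup S] (B A : Set S) : Set S :=
  {x | ∃ b ∈ B, ∃ a ∈ A, b = x * a}

/-- Ditopological Clifford semigroups: for every `x` and every neighborhood `O` of `x` there are
neighborhoods `U` of `x` in `S` and `W` of `π x` in `E` with `(U ÷ W) ∩ π⁻¹(W) ⊆ O`. -/
def IsDitopological (S : Type u) [CliffordSemigroup S] [TopologicalSpace S] : Prop :=
  ∀ x : S, ∀ O ∈ 𝓝 x, ∃ U ∈ 𝓝 x, ∃ W ∈ 𝓝 (proj x),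
    rightDivision U (Subtype.val '' W) ∩ proj ⁻¹' W ⊆ O

end CliffordU

/-!
A compact semigroup containing `S` contains `E` and every `H_e`. It also forces `S` to be
ditopological: if `y e = x` and `y e = y`, where `e = π x`, then `y = x`, and compactness turns
this implication into the required uniform statement (`isDitopological_of_isPrecompact`).

For the converse it suffices to detect each neighborhood `O` of each `x : S` by a continuous
homomorphism into a compact semigroup (`isPrecompact_of_forall_mem_nhds`). Ditopologicity reduces
this to controlling `π y` near `π x` and `y e` near `x e`, for a single idempotent `e ≪ π x` close
to `π x`. The first is done by `π` and a compactification `A` of `E`. For the second, `y ↦ y e`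
is a homomorphism into `H_e` only where `e ≤ π y`. The set `F = {s | e ≪ s}` is an open upper set
of `E` with `π x ∈ F ⊆ ↑e`, so `E \ F` is a closed ideal of `E`, and its closure `J` in `A` is a
closed ideal of `A` with trace `E \ F` on `E` (`exists_closed_ideal`). If `B` is a compactification
of `H_e`, then collapsing the closed ideal `J × B` of `A × B` to a point gives a compact Hausdorff
semigroup, a kind of cone over `B`, and `y ↦ (π y, y e)` becomes a globally defined continuous
homomorphism into it (`exists_cone_hom`), since the second coordinate no longer matters where
`π y ∉ F`. The `U`-property only serves to find the idempotents `e`.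
-/

namespace CliffordU

universe u

/-! ### Precompact semigroups -/

section Precompact

theorem IsPrecompact.of_isEmbedding {X Y : Type u} [Semigroup X] [TopologicalSpace X]
    [Semigroup Y] [TopologicalSpace Y] (hY : IsPrecompact Y) (f : X →ₙ* Y) (hf : IsEmbedding f) :
    IsPrecompact X := by
  obtain ⟨K, i1, i2, h1, h2, h3, h, hh⟩ := hY
  exact ⟨K, i1, i2, h1, h2, h3, h.comp f, hh.comp hf⟩

theorem IsPrecompact.exists_denseRange {X : Type u} [Semigroup X] [TopologicalSpace X]
    (hX : IsPrecompact X) :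
    ∃ (K : Type u) (_ : Semigroup K) (_ : TopologicalSpace K),
      ContinuousMul K ∧ T2Space K ∧ CompactSpace K ∧
        ∃ h : X →ₙ* K, IsEmbedding h ∧ DenseRange h := by
  obtain ⟨K, i1, i2, h1, h2, h3, h, hh⟩ := hX
  let C : Subsemigroup K := h.srange.topologicalClosure
  have hC : IsClosed (C : Set K) := Subsemigroup.isClosed_topologicalClosure _
  have hmem : ∀ x, h x ∈ C := fun x => subset_closure ⟨x, rfl⟩
  let g : X →ₙ* C :=
    { toFun := fun x => ⟨h x, hmem x⟩
      map_mul' := fun x y => Subtype.ext (map_mul h x y) }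
  have hg : IsEmbedding g := IsEmbedding.of_comp
    (hh.continuous.subtype_mk hmem) continuous_subtype_val hh
  refine ⟨C, inferInstance, inferInstance, inferInstance, inferInstance,
    isCompact_iff_compactSpace.1 hC.isCompact, g, hg, fun c => ?_⟩
  rw [closure_subtype]
  refine closure_mono ?_ c.2
  rintro _ ⟨x, rfl⟩
  exact ⟨g x, ⟨x, rfl⟩, rfl⟩

/-- Diagonal embedding: a Hausdorff topological semigroup is precompact as soon as every
neighborhood of every point is detected by a continuous homomorphism to a compact semigroup. -/
theorem isPrecompact_of_forall_mem_nhds {S : Type u} [Semigroup S] [TopologicalSpace S] [T2Space S]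
    (H : ∀ x : S, ∀ O ∈ 𝓝 x, ∃ (K : Type u) (_ : Semigroup K) (_ : TopologicalSpace K),
      ContinuousMul K ∧ T2Space K ∧ CompactSpace K ∧
        ∃ φ : S →ₙ* K, Continuous φ ∧ ∃ N ∈ 𝓝 (φ x), φ ⁻¹' N ⊆ O) :
    IsPrecompact S := by
  choose K iS iT hM hT2 hC φ hφ N hN hNO using H
  let ι : Type u := {p : S × Set S // p.2 ∈ 𝓝 p.1}
  let L : ι → Type u := fun i => K i.1.1 i.1.2 i.2
  let _ : ∀ i, Semigroup (L i) := fun i => iS i.1.1 i.1.2 i.2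
  let _ : ∀ i, TopologicalSpace (L i) := fun i => iT i.1.1 i.1.2 i.2
  have : ∀ i, ContinuousMul (L i) := fun i => hM i.1.1 i.1.2 i.2
  have : ∀ i, T2Space (L i) := fun i => hT2 i.1.1 i.1.2 i.2
  have : ∀ i, CompactSpace (L i) := fun i => hC i.1.1 i.1.2 i.2
  let Φ : S →ₙ* (∀ i, L i) :=
    { toFun := fun s i => φ i.1.1 i.1.2 i.2 s
      map_mul' := fun s t => funext fun i => map_mul (φ i.1.1 i.1.2 i.2) s t }
  have hΦ : Continuous Φ := continuous_pi fun i => hφ i.1.1 i.1.2 i.2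
  refine ⟨∀ i, L i, inferInstance, inferInstance, inferInstance, inferInstance, inferInstance,
    Φ, IsInducing.isEmbedding ?_⟩
  rw [isInducing_iff_nhds]
  intro x
  refine le_antisymm hΦ.continuousAt.le_comap fun O hO => ?_
  let i : ι := ⟨(x, O), hO⟩
  refine ⟨(fun k : ∀ i, L i => k i) ⁻¹' (N x O hO), ?_, hNO x O hO⟩
  exact (continuous_apply i).continuousAt.preimage_mem_nhds (hN x O hO)

end Precompact

/-! ### Rees quotients and cones -/

section Rees

variable {X : Type u} [Semigroup X]

/-- The Rees congruence of a two-sided ideal `J`: it collapses `J` to a single point. For empty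
`J` it is the equality relation. -/
def reesCon (J : Set X) (hl : ∀ a, ∀ j ∈ J, a * j ∈ J) (hr : ∀ a, ∀ j ∈ J, j * a ∈ J) : Con X where
  r a b := a = b ∨ (a ∈ J ∧ b ∈ J)
  iseqv :=
    { refl := fun _ => Or.inl rfl
      symm := by
        rintro a b (h | h)
        exacts [Or.inl h.symm, Or.inr h.symm]
      trans := by
        rintro a b c (rfl | h) (rfl | h')
        exacts [Or.inl rfl, Or.inr h', Or.inr h, Or.inr ⟨h.1, h'.2⟩] }
  mul' := by
    rintro a b c d (rfl | h) (rfl | h')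
    exacts [Or.inl rfl, Or.inr ⟨hl _ _ h'.1, hl _ _ h'.2⟩, Or.inr ⟨hr _ _ h.1, hr _ _ h.2⟩,
      Or.inr ⟨hr _ _ h.1, hr _ _ h.2⟩]

/-- A continuous closed surjection maps normal T₁ spaces onto Hausdorff spaces: its fibres are
disjoint closed sets, and separating neighborhoods of these can be pushed forward. -/
theorem t2Space_of_isClosedMap {X Y : Type*} [TopologicalSpace X] [TopologicalSpace Y]
    [NormalSpace X] {q : X → Y} (hq : Continuous q) (hs : Function.Surjective q)
    (hc : IsClosedMap q) [T1Space X] : T2Space Y := by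
  have hfib : ∀ y, IsClosed (q ⁻¹' {y}) := fun y => by
    obtain ⟨x, rfl⟩ := hs y
    rw [← image_singleton]
    exact (hc _ isClosed_singleton).preimage hq
  refine ⟨fun y z hyz => ?_⟩
  obtain ⟨U, V, hU, hV, hyU, hzV, hUV⟩ := normal_separation (hfib y) (hfib z)
    (by
      rw [disjoint_left]
      rintro a rfl h
      exact hyz h)
  refine ⟨(q '' Uᶜ)ᶜ, (q '' Vᶜ)ᶜ, (hc _ hU.isClosed_compl).isOpen_compl,
    (hc _ hV.isClosed_compl).isOpen_compl, ?_, ?_, ?_⟩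
  · rintro ⟨a, ha, rfl⟩
    exact ha (hyU rfl)
  · rintro ⟨a, ha, rfl⟩
    exact ha (hzV rfl)
  · rw [disjoint_left]
    intro w hw hw'
    obtain ⟨a, rfl⟩ := hs w
    have haU : a ∈ U := by
      by_contra h
      exact hw ⟨a, h, rfl⟩
    have haV : a ∈ V := by
      by_contra h
      exact hw' ⟨a, h, rfl⟩
    exact disjoint_left.1 hUV haU haV

/-- The Rees quotient of a compact Hausdorff semigroup by a closed ideal, described by its
quotient map `q`. -/
theorem exists_rees_quotient [TopologicalSpace X] [ContinuousMul X] [T2Space X] [CompactSpace X]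
    {J : Set X} (hJ : IsClosed J) (hl : ∀ a, ∀ j ∈ J, a * j ∈ J) (hr : ∀ a, ∀ j ∈ J, j * a ∈ J) :
    ∃ (Q : Type u) (_ : Semigroup Q) (_ : TopologicalSpace Q),
      ContinuousMul Q ∧ T2Space Q ∧ CompactSpace Q ∧
        ∃ q : X →ₙ* Q, IsQuotientMap q ∧ ∀ a b, q a = q b ↔ a = b ∨ (a ∈ J ∧ b ∈ J) := by
  let c := reesCon J hl hr
  let q : X →ₙ* c.Quotient := c.mkMulHom
  let _ : TopologicalSpace c.Quotient := inferInstanceAs (TopologicalSpace (Quotient c.toSetoid))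
  have hq : IsQuotientMap q := isQuotientMap_quot_mk
  have hqq : ∀ a b, q a = q b ↔ a = b ∨ (a ∈ J ∧ b ∈ J) := fun a b => c.eq
  have hcl : IsClosedMap q := by
    intro C hC
    rw [← hq.isClosed_preimage]
    by_cases h : (C ∩ J).Nonempty
    · obtain ⟨a, haC, haJ⟩ := h
      convert hC.union hJ using 1
      ext b
      simp only [mem_preimage, mem_image, hqq, mem_union]
      constructor
      · rintro ⟨d, hd, rfl | h⟩
        exacts [Or.inl hd, Or.inr h.2]
      · rintro (h | h)
        exacts [⟨b, h, Or.inl rfl⟩, ⟨a, haC, Or.inr ⟨haJ, h⟩⟩]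
    · convert hC using 1
      ext b
      simp only [mem_preimage, mem_image, hqq]
      constructor
      · rintro ⟨d, hd, rfl | h'⟩
        exacts [hd, (h ⟨d, hd, h'.1⟩).elim]
      · exact fun h => ⟨b, h, Or.inl rfl⟩
  have hT2 : T2Space c.Quotient := t2Space_of_isClosedMap hq.continuous hq.surjective hcl
  have : CompactSpace c.Quotient := hq.surjective.compactSpace hq.continuous
  have hqm : IsQuotientMap (Prod.map q q) :=
    (hq.continuous.prodMap hq.continuous).isClosedMap.isQuotientMap
      (hq.continuous.prodMap hq.continuous) (hq.surjective.prodMap hq.surjective)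
  refine ⟨c.Quotient, inferInstance, inferInstance, ⟨?_⟩, hT2, inferInstance, q, hq, hqq⟩
  rw [hqm.continuous_iff]
  have : (fun p : c.Quotient × c.Quotient => p.1 * p.2) ∘ Prod.map q q
      = fun p : X × X => q (p.1 * p.2) := by
    funext p
    exact (map_mul q _ _).symm
  rw [this]
  exact hq.continuous.comp continuous_mul

end Rees

/-- Extension of a partial homomorphism `g`, defined where the homomorphism `p` avoids a closed
ideal `J`, to a global homomorphism `φ = [(p, g)]` into the cone `(A × B) / (J × B)`. Where
`p x ∉ J`, the value `φ x` still determines `g x`, and does so continuously. Two points where `p`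
avoids `J` may have a product where it does not: there `φ` vanishes whatever `g` is. -/
theorem exists_cone_hom {S A B : Type u} [Semigroup S] [TopologicalSpace S]
    [Semigroup A] [TopologicalSpace A] [ContinuousMul A] [T2Space A] [CompactSpace A]
    [Semigroup B] [TopologicalSpace B] [ContinuousMul B] [T2Space B] [CompactSpace B]
    (p : S →ₙ* A) (hp : Continuous p) {J : Set A} (hJ : IsClosed J)
    (hl : ∀ a, ∀ j ∈ J, a * j ∈ J) (hr : ∀ a, ∀ j ∈ J, j * a ∈ J)
    (g : S → B) (hg : ContinuousOn g (p ⁻¹' Jᶜ))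
    (hmul : ∀ x y, p x ∉ J → p y ∉ J → g (x * y) = g x * g y) :
    ∃ (Q : Type u) (_ : Semigroup Q) (_ : TopologicalSpace Q),
      ContinuousMul Q ∧ T2Space Q ∧ CompactSpace Q ∧
        ∃ φ : S →ₙ* Q, Continuous φ ∧ ∀ x, p x ∉ J → ∀ N ∈ 𝓝 (g x),
          ∃ M ∈ 𝓝 (φ x), ∀ y, φ y ∈ M → p y ∉ J ∧ g y ∈ N := by
  obtain ⟨Q, i1, i2, h1, h2, h3, q, hq, hqq⟩ :=
    exists_rees_quotient (X := A × B) (J := Prod.fst ⁻¹' J) (hJ.preimage continuous_fst)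
      (fun a j hj => hl a.1 j.1 hj) (fun a j hj => hr a.1 j.1 hj)
  let φ : S →ₙ* Q :=
    { toFun := fun x => q (p x, g x)
      map_mul' := fun x y => by
        rw [← map_mul, hqq]
        by_cases hx : p x ∈ J
        · exact Or.inr ⟨by simpa using hr (p y) _ hx, hr (p y) _ hx⟩
        by_cases hy : p y ∈ J
        · exact Or.inr ⟨by simpa using hl (p x) _ hy, hl (p x) _ hy⟩
        exact Or.inl (Prod.ext (map_mul p x y) (hmul x y hx hy)) }
  refine ⟨Q, i1, i2, h1, h2, h3, φ, ?_, ?_⟩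
  · rw [continuous_iff_continuousAt]
    intro x
    by_cases hx : p x ∈ J
    · intro N hN
      obtain ⟨N', hN', hN'o, hxN'⟩ := mem_nhds_iff.1 hN
      -- The whole fibre over `p x` is collapsed to `φ x`, so a tube around it stays near `φ x`.
      obtain ⟨u, v, hu, -, hxu, hv, huv⟩ := generalized_tube_lemma (s := {p x}) (t := univ)
        isCompact_singleton isCompact_univ (hN'o.preimage hq.continuous)
        (by
          rintro ⟨a, b⟩ ⟨ha, -⟩
          obtain rfl : a = p x := ha
          have : q (p x, b) = φ x := (hqq _ _).2 (Or.inr ⟨hx, hx⟩)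
          rw [mem_preimage, this]
          exact hxN')
      have hpu : p ⁻¹' u ∈ 𝓝 x := (hu.preimage hp).mem_nhds (hxu rfl)
      exact Filter.mem_map.2
        (Filter.mem_of_superset hpu fun y hy => hN' (huv ⟨hy, hv (mem_univ _)⟩))
    · have hgx : ContinuousAt g x :=
        hg.continuousAt ((hJ.isOpen_compl.preimage hp).mem_nhds hx)
      exact hq.continuous.continuousAt.comp (hp.continuousAt.prodMk hgx)
  · intro x hx N hN
    obtain ⟨N', hN', hN'o, hxN'⟩ := mem_nhds_iff.1 hN
    -- Off the collapsed ideal `q` is injective, so this set is saturated and its image is open.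
    have key : q ⁻¹' (q '' (Jᶜ ×ˢ N')) = Jᶜ ×ˢ N' := by
      refine Subset.antisymm ?_ (subset_preimage_image _ _)
      rintro b ⟨a, ha, hab⟩
      rcases (hqq _ _).1 hab with rfl | h
      exacts [ha, (ha.1 h.1).elim]
    refine ⟨q '' (Jᶜ ×ˢ N'), IsOpen.mem_nhds ?_ ⟨(p x, g x), ⟨hx, hxN'⟩, rfl⟩, fun y hy => ?_⟩
    · rw [← hq.isOpen_preimage, key]
      exact hJ.isOpen_compl.prod hN'o
    · have hy' : (p y, g y) ∈ q ⁻¹' (q '' (Jᶜ ×ˢ N')) := hy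
      rw [key] at hy'
      exact ⟨hy'.1, hN' hy'.2⟩

/-! ### The way-below relation and closed ideals -/

section Semilattice

variable {E : Type u} [MulSemilattice E]

theorem mem_upperCone {x y : E} : y ∈ upperCone x ↔ x * y = x :=
  ⟨fun h => h.1, fun h => ⟨h, by rw [mul_comm, h]⟩⟩

theorem upperCone_trans {x y z : E} (hy : y ∈ upperCone x) (hz : z ∈ upperCone y) :
    z ∈ upperCone x := by
  rw [mem_upperCone] at *
  rw [← hy, mul_assoc, hz]

theorem mul_mem_upperCone {x y z : E} (hy : y ∈ upperCone x) (hz : z ∈ upperCone x) :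
    y * z ∈ upperCone x := by
  rw [mem_upperCone] at *
  rw [← mul_assoc, hy, hz]

theorem mem_upperCone_mul (x y : E) : y ∈ upperCone (x * y) := by
  rw [mem_upperCone, mul_assoc, MulSemilattice.mul_self]

variable [TopologicalSpace E]

theorem WayBelow.of_mem_upperCone [ContinuousMul E] {x y z : E} (h : WayBelow x y)
    (hz : z ∈ upperCone y) : WayBelow x z := by
  have hyz : y * z = y := mem_upperCone.1 hz
  have hO : IsOpen ((fun t => y * t) ⁻¹' interior (upperCone x)) :=
    isOpen_interior.preimage (continuous_const_mul y)
  refine mem_interior.2 ⟨_, fun t ht => ?_, hO, ?_⟩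
  · exact upperCone_trans (interior_subset ht) (mem_upperCone_mul y t)
  · change y * z ∈ interior (upperCone x)
    rw [hyz]
    exact h

/-- The complement of an open upper set in a dense subsemilattice is the trace of a closed ideal. -/
theorem exists_closed_ideal {A : Type u} [Semigroup A] [TopologicalSpace A] [ContinuousMul A]
    {h : E →ₙ* A} (hh : IsEmbedding h) (hd : DenseRange h) {F : Set E} (hF : IsOpen F)
    (hup : ∀ s t, s ∈ F → t ∈ upperCone s → t ∈ F) :
    ∃ J : Set A, IsClosed J ∧ (∀ a, ∀ j ∈ J, a * j ∈ J) ∧ (∀ a, ∀ j ∈ J, j * a ∈ J) ∧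
      ∀ s, h s ∈ J ↔ s ∉ F := by
  have hI : ∀ s t, t ∉ F → s * t ∉ F := fun s t ht hst => ht (hup _ _ hst (mem_upperCone_mul s t))
  refine ⟨closure (h '' Fᶜ), isClosed_closure, fun a j hj => ?_, fun a j hj => ?_, fun s => ?_⟩
  · refine map_mem_closure₂ continuous_mul (hd a) hj ?_
    rintro _ ⟨s, rfl⟩ _ ⟨t, ht, rfl⟩
    exact ⟨s * t, hI s t ht, map_mul h s t⟩
  · refine map_mem_closure₂ continuous_mul hj (hd a) ?_
    rintro _ ⟨t, ht, rfl⟩ _ ⟨s, rfl⟩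
    exact ⟨t * s, by rw [mul_comm]; exact hI s t ht, map_mul h t s⟩
  · have : s ∈ closure Fᶜ ↔ h s ∈ closure (h '' Fᶜ) := by
      rw [hh.closure_eq_preimage_closure_image, mem_preimage]
    rw [← this, hF.isClosed_compl.closure_eq, mem_compl_iff]

end Semilattice

/-! ### Algebra of Clifford semigroups -/

section Clifford

variable {S : Type u} [CliffordSemigroup S]

open InverseSemigroup CliffordSemigroup

theorem mul_inv_rev (x y : S) : (x * y)⁻¹ = y⁻¹ * x⁻¹ := by
  have hc : x⁻¹ * x * (y * y⁻¹) = y * y⁻¹ * (x⁻¹ * x) := by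
    rw [← mul_inv_eq_inv_mul x]
    exact idem_comm (proj x).2 (proj y).2
  refine (eq_inv _ _ ?_ ?_).symm
  · calc x * y * (y⁻¹ * x⁻¹) * (x * y) = x * (y * y⁻¹ * (x⁻¹ * x)) * y := by
          simp only [mul_assoc]
      _ = (x * x⁻¹ * x) * (y * y⁻¹ * y) := by rw [← hc]; simp only [mul_assoc]
      _ = x * y := by rw [mul_inv_mul, mul_inv_mul]
  · calc y⁻¹ * x⁻¹ * (x * y) * (y⁻¹ * x⁻¹) = y⁻¹ * (x⁻¹ * x * (y * y⁻¹)) * x⁻¹ := by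
          simp only [mul_assoc]
      _ = (y⁻¹ * y * y⁻¹) * (x⁻¹ * x * x⁻¹) := by rw [hc]; simp only [mul_assoc]
      _ = y⁻¹ * x⁻¹ := by rw [inv_mul_inv, inv_mul_inv]

theorem idem_central {e : S} (he : e * e = e) (x : S) : e * x = x * e := by
  have hc : e * (x * x⁻¹) = x * x⁻¹ * e := idem_comm he (proj x).2
  -- The two expressions for `π (x e)` give `x e x⁻¹ = e (x x⁻¹)`.
  have h := mul_inv_eq_inv_mul (x * e)
  rw [mul_inv_rev, ← eq_inv_of_idem he] at h
  have h' : x * e * x⁻¹ = e * (x * x⁻¹) := by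
    calc x * e * x⁻¹ = x * (e * e) * x⁻¹ := by rw [he]
      _ = x * e * (e * x⁻¹) := by simp only [mul_assoc]
      _ = e * (x⁻¹ * x) * e := by rw [h]; simp only [mul_assoc]
      _ = e * e * (x * x⁻¹) := by rw [← mul_inv_eq_inv_mul, mul_assoc, ← hc, mul_assoc]
      _ = e * (x * x⁻¹) := by rw [he]
  calc e * x = e * (x * x⁻¹) * x := by rw [mul_assoc, mul_inv_mul]
    _ = x * (e * (x⁻¹ * x)) := by rw [← h']; simp only [mul_assoc]
    _ = x * (x⁻¹ * x * e) := by rw [← mul_inv_eq_inv_mul, hc]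
    _ = x * x⁻¹ * x * e := by simp only [mul_assoc]
    _ = x * e := by rw [mul_inv_mul]

theorem proj_mul (x y : S) : proj (x * y) = proj x * proj y := by
  apply Subtype.ext
  change x * y * (x * y)⁻¹ = x * x⁻¹ * (y * y⁻¹)
  calc x * y * (x * y)⁻¹ = x * (y * y⁻¹ * x⁻¹) := by rw [mul_inv_rev]; simp only [mul_assoc]
    _ = x * x⁻¹ * (y * y⁻¹) := by
        rw [show y * y⁻¹ * x⁻¹ = x⁻¹ * (y * y⁻¹) from idem_central (proj y).2 _, mul_assoc x]

theorem proj_coe (e : maxSemilattice S) : proj (e : S) = e := by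
  apply Subtype.ext
  change (e : S) * (e : S)⁻¹ = e
  rw [← eq_inv_of_idem e.2]
  exact e.2

theorem mul_proj (x : S) : x * (proj x : S) = x := by
  change x * (x * x⁻¹) = x
  rw [mul_inv_eq_inv_mul, ← mul_assoc, mul_inv_mul]

/-- The projection `π : S → E` is a homomorphism. -/
def projHom : S →ₙ* maxSemilattice S where
  toFun := proj
  map_mul' := proj_mul

theorem mem_maxSubgroup {e : maxSemilattice S} {x : S} : x ∈ maxSubgroup e ↔ proj x = e := by
  constructor
  · exact fun h => Subtype.ext h.1
  · rintro rfl
    exact ⟨rfl, (mul_inv_eq_inv_mul x).symm⟩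

theorem mul_mem_maxSubgroup {e : maxSemilattice S} {x : S} (hx : proj x ∈ upperCone e) :
    x * e ∈ maxSubgroup e := by
  rw [mem_maxSubgroup, proj_mul, proj_coe]
  exact hx.2

theorem continuous_proj [TopologicalSpace S] [ContinuousMul S] [ContinuousInv S] :
    Continuous (proj : S → maxSemilattice S) :=
  (continuous_id.mul continuous_inv).subtype_mk _

open Classical in
/-- The map `x ↦ x e` into `H_e`, given the junk value `e` where `e ≤ π x` fails. -/
noncomputable def retract (e : maxSemilattice S) (x : S) : maxSubgroup e :=
  if hx : proj x ∈ upperCone e then ⟨x * e, mul_mem_maxSubgroup hx⟩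
  else ⟨e, mem_maxSubgroup.2 (proj_coe e)⟩

theorem coe_retract {e : maxSemilattice S} {x : S} (hx : proj x ∈ upperCone e) :
    (retract e x : S) = x * e := by
  simp only [retract, dif_pos hx]

theorem retract_mul {e : maxSemilattice S} {x y : S} (hx : proj x ∈ upperCone e)
    (hy : proj y ∈ upperCone e) : retract e (x * y) = retract e x * retract e y := by
  apply Subtype.ext
  change _ = (retract e x : S) * (retract e y : S)
  rw [coe_retract hx, coe_retract hy, coe_retract (by rw [proj_mul]; exact mul_mem_upperCone hx hy)]
  have he : (e : S) * e = e := e.2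
  calc x * y * (e : S) = x * (y * e * e) := by rw [mul_assoc y, he, mul_assoc]
    _ = x * e * (y * e) := by rw [← idem_central he (y * e)]; simp only [mul_assoc]

theorem continuousOn_retract [TopologicalSpace S] [ContinuousMul S] (e : maxSemilattice S) :
    ContinuousOn (retract e) (proj ⁻¹' upperCone e) := by
  rw [IsInducing.subtypeVal.continuousOn_iff]
  refine (continuous_mul_const (e : S)).continuousOn.congr fun x hx => ?_
  exact coe_retract hx

end Clifford

/-! ### The two implications -/

section Main

variable {S : Type u} [CliffordSemigroup S] [TopologicalSpace S]

theorem isDitopological_of_isPrecompact [ContinuousMul S] [ContinuousInv S]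
    (hS : IsPrecompact S) : IsDitopological S := by
  obtain ⟨K, i1, i2, h1, h2, h3, h, hh⟩ := hS
  intro x O hO
  rw [hh.isInducing.nhds_eq_comap] at hO
  obtain ⟨O', hO', hO'O⟩ := hO
  obtain ⟨O'', hO'', hOo, hxO⟩ := mem_nhds_iff.1 hO'
  let e : S := (proj x : S)
  -- Quadruples `(k, a, b, c)` violating `k a = c` or `k b = k`; at `a = b = h e`, `c = h x` every
  -- `k ≠ h x` does so, and compactness gives a common neighborhood of `(h e, h e, h x)`.
  let n : Set (K × (K × K × K)) := {p | p.1 * p.2.1 = p.2.2.2 ∧ p.1 * p.2.2.1 = p.1}ᶜ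
  have hn : IsOpen n := by
    refine IsClosed.isOpen_compl (self := ?_)
    exact (isClosed_eq (by fun_prop) (by fun_prop)).inter (isClosed_eq (by fun_prop) (by fun_prop))
  have hsub : O''ᶜ ×ˢ {(h e, h e, h x)} ⊆ n := by
    rintro ⟨k, r⟩ ⟨hk, hr⟩ ⟨ha, hb⟩
    obtain rfl : r = (h e, h e, h x) := hr
    have : k = h x := hb.symm.trans ha
    exact hk (this ▸ hxO)
  obtain ⟨u, v, -, hv, hu, hxv, huv⟩ := generalized_tube_lemma
    hOo.isClosed_compl.isCompact isCompact_singleton hn hsub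
  have hv' : v ∈ 𝓝 (h e, h e, h x) := hv.mem_nhds (hxv rfl)
  rw [nhds_prod_eq, nhds_prod_eq, Filter.mem_prod_iff] at hv'
  obtain ⟨W₁, hW₁, V, hV, hWV⟩ := hv'
  obtain ⟨W₂, hW₂, U, hU, hWU⟩ := Filter.mem_prod_iff.1 hV
  have hc : Continuous fun w : maxSemilattice S => h (w : S) :=
    hh.continuous.comp continuous_subtype_val
  refine ⟨h ⁻¹' U, hh.continuous.continuousAt hU, (fun w : maxSemilattice S => h (w : S)) ⁻¹'
    (W₁ ∩ W₂), hc.continuousAt (Filter.inter_mem hW₁ hW₂), ?_⟩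
  rintro y ⟨⟨b, hb, _, ⟨w, hw, rfl⟩, rfl⟩, hy⟩
  refine hO'O (hO'' ?_)
  by_contra hyO
  have := @huv (h y, (h w, h (proj y : S), h (y * w))) ⟨hu hyO, hWV ⟨hw.1, hWU ⟨hy.2, hb⟩⟩⟩
  refine this ⟨(map_mul h _ _).symm, ?_⟩
  change h y * h (proj y : S) = h y
  rw [← map_mul, mul_proj]

theorem isPrecompact_of_isDitopological [T2Space S] [ContinuousMul S] [ContinuousInv S]
    (hU : IsUSemilattice (maxSemilattice S)) (hE : IsPrecompact (maxSemilattice S))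
    (hH : ∀ e : maxSemilattice S, IsPrecompact (maxSubgroup e)) (hS : IsDitopological S) :
    IsPrecompact S := by
  refine isPrecompact_of_forall_mem_nhds fun x O hO => ?_
  obtain ⟨U, hxU, W, hW, hUW⟩ := hS x O hO
  have hV : {w : maxSemilattice S | x * (w : S) ∈ interior U} ∩ interior W ∈ 𝓝 (proj x) := by
    refine Filter.inter_mem ?_ (interior_mem_nhds.2 hW)
    have hc : Continuous fun w : maxSemilattice S => x * (w : S) := by fun_prop
    refine hc.continuousAt.preimage_mem_nhds ?_
    rw [mul_proj]
    exact isOpen_interior.mem_nhds (mem_interior_iff_mem_nhds.2 hxU)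
  obtain ⟨V, hVs, hVo, hxV⟩ := mem_nhds_iff.1 hV
  -- As `x (π x) = x`, an idempotent `e ≪ π x` close enough to `π x` has `x e ∈ U`.
  obtain ⟨e, heV, hex⟩ := hU V hVo _ hxV
  obtain ⟨hxe, heW⟩ := hVs heV
  have : ContinuousMul (maxSemilattice S) :=
    inferInstanceAs (ContinuousMul (maxSemilattice S : Subsemigroup S))
  obtain ⟨A, _, _, _, _, _, α, hα, hαd⟩ := hE.exists_denseRange
  obtain ⟨B, _, _, _, _, _, β, hβ⟩ := hH e
  obtain ⟨J, hJ, hl, hr, hJF⟩ := exists_closed_ideal hα hαd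
    (F := interior (upperCone e)) isOpen_interior fun s t hs ht => WayBelow.of_mem_upperCone hs ht
  let p : S →ₙ* A := α.comp projHom
  have hp : Continuous p := hα.continuous.comp continuous_proj
  have hpJ : ∀ {y}, p y ∉ J → proj y ∈ upperCone e := fun {y} hy =>
    interior_subset (not_not.1 fun h => hy ((hJF _).2 h))
  obtain ⟨Q, _, _, _, _, _, φ, hφ, hφN⟩ := exists_cone_hom p hp hJ hl hr
    (fun y => β (retract e y))
    (hβ.continuous.comp_continuousOn ((continuousOn_retract e).mono fun y hy => hpJ hy))
    (fun y z hy hz => by rw [retract_mul (hpJ hy) (hpJ hz), map_mul])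
  have hxJ : p x ∉ J := fun h => (hJF _).1 h hex
  have hN : Subtype.val ⁻¹' U ∈ 𝓝 (retract e x) := by
    refine continuous_subtype_val.continuousAt.preimage_mem_nhds ?_
    rw [coe_retract (hpJ hxJ)]
    exact mem_interior_iff_mem_nhds.1 hxe
  rw [hβ.isInducing.nhds_eq_comap] at hN
  obtain ⟨N, hN, hNU⟩ := hN
  obtain ⟨M, hM, hMy⟩ := hφN x hxJ N hN
  have hW' := hW
  rw [hα.isInducing.nhds_eq_comap] at hW'
  obtain ⟨R, hR, hRW⟩ := hW'
  refine ⟨A × Q, inferInstance, inferInstance, inferInstance, inferInstance, inferInstance,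
    p.prod φ, hp.prodMk hφ, R ×ˢ M, prod_mem_nhds hR hM, fun y hy => ?_⟩
  obtain ⟨hyJ, hyN⟩ := hMy y hy.2
  have hyU : (retract e y : S) ∈ U := hNU hyN
  rw [coe_retract (hpJ hyJ)] at hyU
  exact hUW ⟨⟨_, hyU, _, ⟨e, interior_subset heW, rfl⟩, rfl⟩, hRW hy.1⟩

end Main

end CliffordU

theorem mainTheorem3 (S : Type*) [CliffordU.CliffordSemigroup S] [TopologicalSpace S]
    [T2Space S] [ContinuousMul S] [ContinuousInv S]
    (hU : CliffordU.IsUSemilattice (CliffordU.maxSemilattice S)) :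
    CliffordU.IsPrecompact S ↔
      CliffordU.IsPrecompact (CliffordU.maxSemilattice S) ∧
      (∀ e : CliffordU.maxSemilattice S, CliffordU.IsPrecompact (CliffordU.maxSubgroup e)) ∧
      CliffordU.IsDitopological S := by
  constructor
  · intro hS
    exact ⟨hS.of_isEmbedding (MulMemClass.subtype (CliffordU.maxSemilattice S)) .subtypeVal,
      fun e => hS.of_isEmbedding (MulMemClass.subtype (CliffordU.maxSubgroup e)) .subtypeVal,
      CliffordU.isDitopological_of_isPrecompact hS⟩
  · rintro ⟨hE, hH, hD⟩
    exact CliffordU.isPrecompact_of_isDitopological hU hE hH hD
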